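/- There is a semidirect product $Q_{16}\rtimes_{\varphi}\mathbb{Z}/6\mathbb{Z}$ of the generalized quaternion group $Q_{16}$ of order 16 by the cyclic group $\mathbb{Z}/6\mathbb{Z}$ (for some action $\varphi:\mathbb{Z}/6\mathbb{Z}\to\mathrm{Aut}(Q_{16})$), not isomorphic to the direct product $Q_{16}\times\mathbb{Z}/6\mathbb{Z}$, with the following property. Let $K$ be any field with $\mathrm{char}(K)\neq 2,3$, let $b\in K$ be such that $\mathcal{E}_1: y^2=x^3+bx$ is an elliptic curve, and let $K_7=K(\mathcal{E}_1[7])$ be the subfield of an algebraic closure $\overline{K}$ of $K$ generated over $K$ by the coordinates of the points $P\in\mathcal{E}_1(\overline{K})$ with $7P=O$. Then $K_7/K$ is a Galois extension and $\mathrm{Gal}(K_7/K)$ is isomorphic to a subgroup of $Q_{16}\rtimes_{\varphi}\mathbb{Z}/6\mathbb{Z}$. If moreover $[K_7:K]=96$, then $\mathrm{Gal}(K_7/K)\simeq Q_{16}\rtimes_{\varphi}\mathbb{Z}/6\mathbb{Z}$. -/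

import Mathlib

/-- The Weierstrass curve `y ^ 2 = x ^ 3 + b * x` over `K`. -/
def curveE1 {K : Type*} [Field K] (b : K) : WeierstrassCurve K where
  a₁ := 0
  a₂ := 0
  a₃ := 0
  a₄ := b
  a₆ := 0

open Classical in
/-- The `m`-th division field `K(W[m])` of a Weierstrass curve `W` over `K`: the subfield of the
algebraic closure of `K` generated over `K` by the affine coordinates of all geometric points `P`
of `W` with `m • P = 0`. -/
noncomputable def divisionField {K : Type*} [Field K] (W : WeierstrassCurve K) (m : ℕ) :
    IntermediateField K (AlgebraicClosure K) :=
  IntermediateField.adjoin K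
    {z | ∃ (x y : AlgebraicClosure K)
      (h : (W.baseChange (AlgebraicClosure K)).toAffine.Nonsingular x y),
        m • WeierstrassCurve.Affine.Point.some x y h = 0 ∧ (z = x ∨ z = y)}

/-!
Complex multiplication by `i`, the map `J : (x, y) ↦ (-x, -iy)`, satisfies `J² = -1`, and every
Galois automorphism commutes or anticommutes with it on `E[7]`. Since `-1` is not a square
modulo `7` and `E[7]` has at most `2 · 24 + 1 = 49` points, `24` being the degree of the
`7`-division polynomial, `E[7]` is either trivial or a line over `𝔽₄₉ = 𝔽₇(i)` on which Galois acts
by maps `z ↦ az` and `z ↦ az̄`. These form a group of order `96`, the semidirect product of a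
`Q₁₆` by the cyclic group generated by `z ↦ 2z̄`; if the degree of the division field is `96`, the
Galois group is all of it.

Separability away from characteristic `7`: a derivation moves each point along the invariant vector
field with a velocity that is additive in the point, so it is killed by `7` at a point of `E[7]`,
and the derivation vanishes on the coordinates. In characteristic `7` the curve is supersingular
and `E[7]` is trivial.
-/

section SemilinearGroup

open Matrix

/-- Complex conjugation on `k(i)` in the basis `1, i`. -/
def conjMatrix (k : Type*) [Ring k] : Matrix (Fin 2) (Fin 2) k := !![1, 0; 0, -1]

/-- Multiplication by `i` on `k(i)` in the basis `1, i`. -/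
def imMatrix (k : Type*) [Ring k] : Matrix (Fin 2) (Fin 2) k := !![0, -1; 1, 0]

/-- Multiplication by `(2 + 3i)²` on `𝔽₄₉ = 𝔽₇(i)`, an element of order `8` and norm `1`. -/
def rotMatrix : Matrix (Fin 2) (Fin 2) (ZMod 7) := !![2, 2; 5, 2]

/-- The semilinear map `z ↦ (2 + 3i) z̄` of `𝔽₄₉ = 𝔽₇(i)`, whose square is `-1`. -/
def flipMatrix : Matrix (Fin 2) (Fin 2) (ZMod 7) := !![2, 3; 3, -2]

theorem pow_zmod_val_add {M : Type*} [Monoid M] {n : ℕ} [NeZero n] {x : M} (hx : x ^ n = 1)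
    (i j : ZMod n) : x ^ (i + j).val = x ^ i.val * x ^ j.val := by
  rw [ZMod.val_add, ← pow_eq_pow_mod _ hx, pow_add]

/-- The homomorphism from the cyclic group of order `n` sending its generator to an element `x`
with `x ^ n = 1`. -/
def zmodPowHom {M : Type*} [Monoid M] {n : ℕ} [NeZero n] (x : M) (hx : x ^ n = 1) :
    Multiplicative (ZMod n) →* M where
  toFun g := x ^ g.toAdd.val
  map_one' := by simp
  map_mul' g h := by simp [pow_zmod_val_add hx]

/-- The faithful representation of `Q₁₆` by semilinear maps of `𝔽₄₉`. -/
def quaternionRep : QuaternionGroup 4 →* Matrix (Fin 2) (Fin 2) (ZMod 7) where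
  toFun
    | .a i => rotMatrix ^ i.val
    | .xa i => flipMatrix * rotMatrix ^ i.val
  map_one' := by decide
  map_mul' := by decide +kernel

/-- The automorphism of `Q₁₆` induced by conjugation on `𝔽₄₉`; the shift by `3` comes from
`w̄ = w w̄⁻⁶` for `w = 2 + 3i`. -/
def conjAut : MulAut (QuaternionGroup 4) where
  toFun
    | .a i => .a (-i)
    | .xa i => .xa (-i - 3)
  invFun
    | .a i => .a (-i)
    | .xa i => .xa (-i - 3)
  left_inv := by rintro (i | i) <;> simp
  right_inv := by rintro (i | i) <;> simp
  map_mul' := by decide +kernel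

theorem conjAut_pow_six : conjAut ^ 6 = 1 := by
  ext q
  revert q
  decide +kernel

/-- The action of `ℤ/6` on `Q₁₆` through `conjAut`. -/
def semilinearAction : Multiplicative (ZMod 6) →* MulAut (QuaternionGroup 4) :=
  zmodPowHom conjAut conjAut_pow_six

/-- The representation of `ℤ/6` on `𝔽₄₉` whose generator acts by `z ↦ 2 z̄`. -/
def cyclicRep : Multiplicative (ZMod 6) →* Matrix (Fin 2) (Fin 2) (ZMod 7) :=
  zmodPowHom (2 • conjMatrix (ZMod 7)) (by decide +kernel)

theorem quaternionRep_semilinearAction_mul_cyclicRep (g : Multiplicative (ZMod 6))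
    (q : QuaternionGroup 4) :
    quaternionRep (semilinearAction g q) * cyclicRep g = cyclicRep g * quaternionRep q := by
  revert g q
  decide +kernel

/-- The representation of `Q₁₆ ⋊ ℤ/6` by semilinear maps of `𝔽₄₉`. -/
def semilinearRep :
    QuaternionGroup 4 ⋊[semilinearAction] Multiplicative (ZMod 6) →* GL (Fin 2) (ZMod 7) :=
  SemidirectProduct.lift quaternionRep.toHomUnits cyclicRep.toHomUnits fun g ↦ by
    ext1 q
    exact eq_mul_inv_iff_mul_eq.mpr
      (Units.ext (quaternionRep_semilinearAction_mul_cyclicRep g q))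

theorem coe_semilinearRep_mk (q : QuaternionGroup 4) (g : Multiplicative (ZMod 6)) :
    (semilinearRep ⟨q, g⟩ : Matrix (Fin 2) (Fin 2) (ZMod 7)) = quaternionRep q * cyclicRep g :=
  rfl

theorem semilinearRep_injective : Function.Injective semilinearRep := by
  have trivial_of_mul_eq_one : ∀ (q : QuaternionGroup 4) (g : Multiplicative (ZMod 6)),
      quaternionRep q * cyclicRep g = 1 → q = 1 ∧ g = 1 := by decide +kernel
  rw [injective_iff_map_eq_one]
  rintro ⟨q, g⟩ h
  obtain ⟨rfl, rfl⟩ := trivial_of_mul_eq_one q g (congr_arg Units.val h)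
  rfl

theorem eq_of_commute_imMatrix {k : Type*} [CommRing k] {M : Matrix (Fin 2) (Fin 2) k}
    (h : M * imMatrix k = imMatrix k * M) : M = !![M 0 0, -M 1 0; M 1 0, M 0 0] := by
  rw [M.eta_fin_two, imMatrix, mul_fin_two, mul_fin_two] at h
  have h₀ : M 0 1 = -M 1 0 := by simpa using congr_fun₂ h 0 0
  have h₁ : M 1 1 = M 0 0 := by simpa using congr_fun₂ h 1 0
  rw [← h₀]
  nth_rw 2 [← h₁]
  exact M.eta_fin_two

theorem eq_of_anticommute_imMatrix {k : Type*} [CommRing k] {M : Matrix (Fin 2) (Fin 2) k}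
    (h : M * imMatrix k = -(imMatrix k * M)) : M = !![M 0 0, M 1 0; M 1 0, -M 0 0] := by
  rw [M.eta_fin_two, imMatrix, mul_fin_two, mul_fin_two] at h
  have h₀ : M 0 1 = M 1 0 := by simpa using congr_fun₂ h 0 0
  have h₁ : M 1 1 = -M 0 0 := by simpa using congr_fun₂ h 1 0
  rw [← h₁]
  nth_rw 1 [← h₀]
  exact M.eta_fin_two

theorem exists_coe_semilinearRep_eq {M : Matrix (Fin 2) (Fin 2) (ZMod 7)} (hM : M ≠ 0)
    (h : M * imMatrix (ZMod 7) = imMatrix (ZMod 7) * M ∨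
      M * imMatrix (ZMod 7) = -(imMatrix (ZMod 7) * M)) :
    ∃ s, (semilinearRep s : Matrix (Fin 2) (Fin 2) (ZMod 7)) = M := by
  have linear_and_semilinear : ∀ m n : ZMod 7, ¬(m = 0 ∧ n = 0) →
      (∃ q g, quaternionRep q * cyclicRep g = !![m, -n; n, m]) ∧
      (∃ q g, quaternionRep q * cyclicRep g = !![m, n; n, -m]) := by decide +kernel
  have hM' : M = !![M 0 0, -M 1 0; M 1 0, M 0 0] ∨ M = !![M 0 0, M 1 0; M 1 0, -M 0 0] :=
    h.imp eq_of_commute_imMatrix eq_of_anticommute_imMatrix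
  have h0 : ¬(M 0 0 = 0 ∧ M 1 0 = 0) := by
    rintro ⟨h₀, h₁⟩
    refine hM ?_
    rcases hM' with e | e <;> simpa [h₀, h₁, ← Matrix.ext_iff] using e
  obtain ⟨⟨q, g, hl⟩, ⟨q', g', hs⟩⟩ := linear_and_semilinear _ _ h0
  rcases hM' with e | e
  · exact ⟨⟨q, g⟩, hl.trans e.symm⟩
  · exact ⟨⟨q', g'⟩, hs.trans e.symm⟩

-- The element `(xa 0, 3)` acts on `𝔽₄₉` as multiplication by `2 + 3i`, so it has order `16`,
-- whereas the exponent of `Q₁₆ × ℤ/6` is `24`.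
theorem isEmpty_semidirectProduct_mulEquiv_prod :
    IsEmpty ((QuaternionGroup 4 ⋊[semilinearAction] Multiplicative (ZMod 6)) ≃*
      (QuaternionGroup 4 × Multiplicative (ZMod 6))) := by
  refine ⟨fun e ↦ ?_⟩
  have pow_quaternion : ∀ q : QuaternionGroup 4, q ^ 24 = 1 := by decide +kernel
  have pow_cyclic : ∀ g : Multiplicative (ZMod 6), g ^ 24 = 1 := by decide +kernel
  have pow_matrix : (quaternionRep (.xa 0) * cyclicRep (.ofAdd 3)) ^ 24 ≠ 1 := by decide +kernel
  have pow_semidirect : (⟨.xa 0, .ofAdd 3⟩ : QuaternionGroup 4 ⋊[semilinearAction] _) ^ 24 = 1 :=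
    e.injective <| by rw [map_pow, map_one]; exact Prod.ext (pow_quaternion _) (pow_cyclic _)
  apply pow_matrix
  rw [← coe_semilinearRep_mk, ← Units.val_pow_eq_pow_val, ← map_pow, pow_semidirect, map_one,
    Units.val_one]

theorem card_semidirectProduct :
    Nat.card (QuaternionGroup 4 ⋊[semilinearAction] Multiplicative (ZMod 6)) = 96 := by
  rw [SemidirectProduct.card]
  simp [QuaternionGroup.card]

end SemilinearGroup

section QuarterTurn

variable {k V : Type*} [Field k] [AddCommGroup V] [Module k V]

theorem apply_apply_of_mul_self_eq_neg_one {J : Module.End k V} (hJ : J * J = -1) (v : V) :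
    J (J v) = -v := by
  simpa using LinearMap.congr_fun hJ v

theorem linearIndependent_pair_of_mul_self_eq_neg_one (hk : ¬IsSquare (-1 : k))
    {J : Module.End k V} (hJ : J * J = -1) {v : V} (hv : v ≠ 0) :
    LinearIndependent k ![v, J v] := by
  rw [LinearIndependent.pair_iff' hv]
  intro a ha
  have haa : (a * a) • v = (-1 : k) • v := by
    rw [mul_smul, ha, ← map_smul, ha, apply_apply_of_mul_self_eq_neg_one hJ, neg_one_smul]
  exact hk ⟨a, (smul_left_injective k hv haa).symm⟩

theorem exists_basis_toMatrixAlgEquiv_eq_imMatrix (hk : ¬IsSquare (-1 : k))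
    {J : Module.End k V} (hJ : J * J = -1) (hV : Module.finrank k V = 2) :
    ∃ B : Module.Basis (Fin 2) k V, LinearMap.toMatrixAlgEquiv B J = imMatrix k := by
  have : Nontrivial V := Module.nontrivial_of_finrank_pos (R := k) (by omega)
  obtain ⟨v, hv⟩ := exists_ne (0 : V)
  have hli := linearIndependent_pair_of_mul_self_eq_neg_one hk hJ hv
  let B := basisOfLinearIndependentOfCardEqFinrank hli (by simp [hV])
  have hB₀ : J (B 0) = B 1 := by simp [B]
  have hB₁ : J (B 1) = -B 0 := by rw [← hB₀, apply_apply_of_mul_self_eq_neg_one hJ]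
  refine ⟨B, ?_⟩
  ext i j
  fin_cases j <;> fin_cases i <;> simp [LinearMap.toMatrixAlgEquiv_apply, hB₀, hB₁, imMatrix]

end QuarterTurn

theorem exists_comp_eq_of_range_le {G H T : Type*} [Group G] [Group H] [Group T] {f : G →* H}
    {r : T →* H} (hr : Function.Injective r) (h : f.range ≤ r.range) :
    ∃ g : G →* T, r.comp g = f :=
  ⟨((MonoidHom.ofInjective hr).symm : r.range →* T).comp
    (f.codRestrict r.range fun x ↦ h ⟨x, rfl⟩), by ext x; simp⟩

instance fact_prime_seven : Fact (Nat.Prime 7) := ⟨by norm_num⟩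

theorem exists_hom_semidirectProduct_ker_eq {V G : Type*} [AddCommGroup V] [Module (ZMod 7) V]
    [Module.Finite (ZMod 7) V] [Group G] (hV : Module.finrank (ZMod 7) V ≤ 2)
    {J : Module.End (ZMod 7) V} (hJ : J * J = -1)
    (ρ : G →* Module.End (ZMod 7) V) (hρ : ∀ g, ρ g * J = J * ρ g ∨ ρ g * J = -(J * ρ g)) :
    ∃ f : G →* QuaternionGroup 4 ⋊[semilinearAction] Multiplicative (ZMod 6),
      f.ker = ρ.ker := by
  have not_isSquare : ¬IsSquare (-1 : ZMod 7) := by decide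
  rcases subsingleton_or_nontrivial V with _ | _
  · exact ⟨1, by ext g; simp [Subsingleton.elim (ρ g) 1]⟩
  obtain ⟨v, hv⟩ := exists_ne (0 : V)
  have hli := linearIndependent_pair_of_mul_self_eq_neg_one not_isSquare hJ hv
  have hrank : Module.finrank (ZMod 7) V = 2 :=
    hV.antisymm (by simpa using hli.fintype_card_le_finrank)
  obtain ⟨B, hB⟩ := exists_basis_toMatrixAlgEquiv_eq_imMatrix not_isSquare hJ hrank
  let e := LinearMap.toMatrixAlgEquiv B
  let r : G →* GL (Fin 2) (ZMod 7) := ((e : Module.End (ZMod 7) V →* _).comp ρ).toHomUnits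
  have hr : r.range ≤ semilinearRep.range := by
    rintro _ ⟨g, rfl⟩
    have he : e (ρ g) * imMatrix (ZMod 7) = imMatrix (ZMod 7) * e (ρ g) ∨
        e (ρ g) * imMatrix (ZMod 7) = -(imMatrix (ZMod 7) * e (ρ g)) := by
      rw [← hB, ← map_mul, ← map_mul, ← map_neg, e.injective.eq_iff, e.injective.eq_iff]
      exact hρ g
    obtain ⟨s, hs⟩ := exists_coe_semilinearRep_eq (r g).ne_zero he
    exact ⟨s, Units.ext hs⟩
  obtain ⟨f, hf⟩ := exists_comp_eq_of_range_le semilinearRep_injective hr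
  refine ⟨f, ?_⟩
  ext g
  rw [MonoidHom.mem_ker, MonoidHom.mem_ker, ← map_eq_one_iff _ semilinearRep_injective,
    ← MonoidHom.comp_apply, hf, Units.ext_iff]
  exact EmbeddingLike.map_eq_one_iff (f := e)

section InvariantVelocity

open Polynomial WeierstrassCurve.Affine

variable {R F : Type*} [CommRing R] [Field F] [Algebra R F]

theorem slope_mul_sub [DecidableEq F] {W : WeierstrassCurve.Affine F} {x₁ x₂ y₁ y₂ : F}
    (h₁ : W.Equation x₁ y₁) (h₂ : W.Equation x₂ y₂) (hxy : ¬(x₁ = x₂ ∧ y₁ = W.negY x₂ y₂)) :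
    W.slope x₁ x₂ y₁ y₂ * (x₁ - x₂) = y₁ - y₂ := by
  by_cases hx : x₁ = x₂
  · rw [hx, sub_self, mul_zero, Y_eq_of_Y_ne h₁ h₂ hx fun hy ↦ hxy ⟨hx, hy⟩, sub_self]
  · rw [slope_of_X_ne hx, div_mul_cancel₀ _ (sub_ne_zero.mpr hx)]

theorem slope_mul_sub_negY [DecidableEq F] {W : WeierstrassCurve.Affine F} {x y : F}
    (hy : y ≠ W.negY x y) :
    W.slope x x y y * (2 * y + W.a₁ * x + W.a₃) =
      3 * x ^ 2 + 2 * W.a₂ * x + W.a₄ - W.a₁ * y := by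
  rw [slope_of_Y_ne rfl hy, div_mul_eq_mul_div, div_eq_iff (sub_ne_zero.mpr hy), negY]
  ring

theorem gradient_along_line [DecidableEq F] {W : WeierstrassCurve.Affine F} {x₁ x₂ y₁ y₂ : F}
    (h₁ : W.Equation x₁ y₁) (h₂ : W.Equation x₂ y₂) (hxy : ¬(x₁ = x₂ ∧ y₁ = W.negY x₂ y₂))
    {ℓ x₃ : F} (hℓ : ℓ = W.slope x₁ x₂ y₁ y₂) (hx₃ : x₃ = W.addX x₁ x₂ ℓ)
    {x y : F} (hy : y = ℓ * (x - x₁) + y₁) :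
    3 * x ^ 2 + 2 * W.a₂ * x + W.a₄ - W.a₁ * y - ℓ * (2 * y + W.a₁ * x + W.a₃) =
      (x - x₁) * (x - x₂) + (x - x₁) * (x - x₃) + (x - x₂) * (x - x₃) := by
  have h := congr_arg (eval x) (derivative_addPolynomial_slope h₁ h₂ hxy)
  rw [← hℓ, ← hx₃, addPolynomial_eq, Cubic.toPoly] at h
  simp only [derivative_neg, derivative_add, derivative_C_mul, derivative_X_pow, derivative_X,
    derivative_C, eval_neg, eval_add, eval_sub, eval_mul, eval_pow, eval_C, eval_X, eval_one,
    eval_zero] at h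
  rw [hy]
  push_cast at h
  linear_combination -h

/-- The derivation `D` moves the point `(x, y)` with velocity `u` along the invariant vector field,
the one dual to the invariant differential `dx / (2y + a₁x + a₃)`. -/
def HasVelocity (W : WeierstrassCurve.Affine F) (D : Derivation R F F) (x y u : F) : Prop :=
  D x = (2 * y + W.a₁ * x + W.a₃) * u ∧
    D y = (3 * x ^ 2 + 2 * W.a₂ * x + W.a₄ - W.a₁ * y) * u

theorem HasVelocity.unique {W : WeierstrassCurve.Affine F} {D : Derivation R F F} {x y u v : F}
    (h : W.Nonsingular x y) (hu : HasVelocity W D x y u) (hv : HasVelocity W D x y v) : u = v := by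
  rcases ((W.nonsingular_iff' x y).mp h).2 with h | h
  · rw [← neg_ne_zero, neg_sub] at h
    exact mul_left_cancel₀ h (hu.2.symm.trans hv.2)
  · exact mul_left_cancel₀ h (hu.1.symm.trans hv.1)

variable {W : WeierstrassCurve.Affine R} {D : Derivation R F F}

theorem derivation_coefficients (D : Derivation R F F) (W : WeierstrassCurve.Affine R) :
    D (W⁄F).a₁ = 0 ∧ D (W⁄F).a₂ = 0 ∧ D (W⁄F).a₃ = 0 ∧ D (W⁄F).a₄ = 0 ∧ D (W⁄F).a₆ = 0 :=
  ⟨D.map_algebraMap _, D.map_algebraMap _, D.map_algebraMap _, D.map_algebraMap _,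
    D.map_algebraMap _⟩

theorem derivation_equation {x y : F} (D : Derivation R F F) (h : (W⁄F).Equation x y) :
    (2 * y + (W⁄F).a₁ * x + (W⁄F).a₃) * D y =
      (3 * x ^ 2 + 2 * (W⁄F).a₂ * x + (W⁄F).a₄ - (W⁄F).a₁ * y) * D x := by
  obtain ⟨ha₁, ha₂, ha₃, ha₄, ha₆⟩ := derivation_coefficients D W
  have h := congr_arg D (((W⁄F).equation_iff x y).mp h)
  simp only [map_add, Derivation.leibniz, Derivation.leibniz_pow, smul_eq_mul, nsmul_eq_mul,
    ha₁, ha₂, ha₃, ha₄, ha₆] at h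
  push_cast at h
  linear_combination h

theorem exists_hasVelocity {x y : F} (D : Derivation R F F) (h : (W⁄F).Nonsingular x y) :
    ∃ u, HasVelocity (W⁄F) D x y u := by
  have hD := derivation_equation D h.1
  rcases (((W⁄F).nonsingular_iff' x y).mp h).2 with hx | hy
  · rw [← neg_ne_zero, neg_sub] at hx
    exact ⟨D y / _, (eq_div_of_mul_eq hx (by rw [mul_comm, hD.symm])).trans (mul_div_assoc ..),
      (mul_div_cancel₀ _ hx).symm⟩
  · exact ⟨D x / _, (mul_div_cancel₀ _ hy).symm,
      (eq_div_of_mul_eq hy (by rw [mul_comm, hD])).trans (mul_div_assoc ..)⟩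

theorem HasVelocity.neg {x y u : F} (h : HasVelocity (W⁄F) D x y u) :
    HasVelocity (W⁄F) D x ((W⁄F).negY x y) (-u) := by
  obtain ⟨hx, hy⟩ := h
  obtain ⟨ha₁, -, ha₃, -⟩ := derivation_coefficients D W
  simp only [HasVelocity, negY, map_sub, map_neg, Derivation.leibniz, smul_eq_mul, ha₁, ha₃]
  constructor
  · linear_combination hx
  · linear_combination -hy - (W⁄F).a₁ * hx

section Add

variable [DecidableEq F] {x₁ y₁ u₁ x₂ y₂ u₂ ℓ x₃ : F}

theorem derivation_slope_of_Y_ne {x y u : F} (hy : y ≠ (W⁄F).negY x y)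
    (hu : HasVelocity (W⁄F) D x y u) (hℓ : ℓ = (W⁄F).slope x x y y) :
    D ℓ = 2 * (x - (W⁄F).addX x x ℓ) * u := by
  obtain ⟨ha₁, ha₂, ha₃, ha₄, -⟩ := derivation_coefficients D W
  obtain ⟨hDx, hDy⟩ := hu
  have tangent := slope_mul_sub_negY hy
  rw [← hℓ] at tangent
  rw [← tangent] at hDy
  have hD := congr_arg D tangent
  have hD2 : D (2 : F) = 0 := D.map_natCast 2
  have hD3 : D (3 : F) = 0 := D.map_natCast 3
  simp only [map_add, map_sub, Derivation.leibniz, Derivation.leibniz_pow, smul_eq_mul,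
    nsmul_eq_mul, ha₁, ha₂, ha₃, ha₄, hD2, hD3, hDx, hDy] at hD
  push_cast at hD
  have hd : 2 * y + (W⁄F).a₁ * x + (W⁄F).a₃ ≠ 0 := by
    rw [negY, ← sub_ne_zero] at hy
    convert hy using 1
    ring
  apply mul_left_cancel₀ hd
  rw [addX]
  linear_combination hD

theorem derivation_slope (h₁ : (W⁄F).Nonsingular x₁ y₁) (h₂ : (W⁄F).Nonsingular x₂ y₂)
    (hxy : ¬(x₁ = x₂ ∧ y₁ = (W⁄F).negY x₂ y₂))
    (hu₁ : HasVelocity (W⁄F) D x₁ y₁ u₁) (hu₂ : HasVelocity (W⁄F) D x₂ y₂ u₂)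
    (hℓ : ℓ = (W⁄F).slope x₁ x₂ y₁ y₂) (hx₃ : x₃ = (W⁄F).addX x₁ x₂ ℓ) :
    D ℓ = (x₁ - x₃) * u₁ + (x₂ - x₃) * u₂ := by
  have on_line : ℓ * (x₁ - x₂) = y₁ - y₂ := hℓ ▸ slope_mul_sub h₁.1 h₂.1 hxy
  by_cases hx : x₁ = x₂
  · obtain rfl := hx
    obtain rfl := Y_eq_of_Y_ne h₁.1 h₂.1 rfl fun hy ↦ hxy ⟨rfl, hy⟩
    rw [derivation_slope_of_Y_ne (fun hy ↦ hxy ⟨rfl, hy⟩) hu₁ hℓ, ← hu₁.unique h₁ hu₂, hx₃]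
    ring
  · have gradient₁ := gradient_along_line h₁.1 h₂.1 hxy hℓ hx₃ (x := x₁) (y := y₁) (by ring)
    have gradient₂ := gradient_along_line h₁.1 h₂.1 hxy hℓ hx₃ (x := x₂) (y := y₂)
      (by linear_combination on_line)
    have hD := congr_arg D on_line
    rw [Derivation.leibniz, map_sub, map_sub, smul_eq_mul, smul_eq_mul, hu₁.1, hu₁.2, hu₂.1,
      hu₂.2] at hD
    apply mul_left_cancel₀ (sub_ne_zero.mpr hx)
    linear_combination hD + u₁ * gradient₁ - u₂ * gradient₂

-- The third point of intersection with the line through the two points has velocity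
-- `-(u₁ + u₂)`: this is Abel's addition theorem for the invariant differential.
theorem HasVelocity.add (h₁ : (W⁄F).Nonsingular x₁ y₁) (h₂ : (W⁄F).Nonsingular x₂ y₂)
    (hxy : ¬(x₁ = x₂ ∧ y₁ = (W⁄F).negY x₂ y₂))
    (hu₁ : HasVelocity (W⁄F) D x₁ y₁ u₁) (hu₂ : HasVelocity (W⁄F) D x₂ y₂ u₂)
    (hℓ : ℓ = (W⁄F).slope x₁ x₂ y₁ y₂) :
    HasVelocity (W⁄F) D ((W⁄F).addX x₁ x₂ ℓ) ((W⁄F).addY x₁ x₂ y₁ ℓ) (u₁ + u₂) := by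
  obtain ⟨ha₁, ha₂, -⟩ := derivation_coefficients D W
  have on_line : ℓ * (x₁ - x₂) = y₁ - y₂ := hℓ ▸ slope_mul_sub h₁.1 h₂.1 hxy
  obtain ⟨x₃, hx₃⟩ : ∃ x₃, x₃ = (W⁄F).addX x₁ x₂ ℓ := ⟨_, rfl⟩
  obtain ⟨y₃, hy₃⟩ : ∃ y₃, y₃ = ℓ * (x₃ - x₁) + y₁ := ⟨_, rfl⟩
  have hDℓ := derivation_slope h₁ h₂ hxy hu₁ hu₂ hℓ hx₃
  have gradient₁ := gradient_along_line h₁.1 h₂.1 hxy hℓ hx₃ (x := x₁) (y := y₁) (by ring)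
  have gradient₃ := gradient_along_line h₁.1 h₂.1 hxy hℓ hx₃ hy₃
  have third_point : HasVelocity (W⁄F) D x₃ y₃ (-(u₁ + u₂)) := by
    have hDx : D x₃ = (2 * y₃ + (W⁄F).a₁ * x₃ + (W⁄F).a₃) * -(u₁ + u₂) := by
      have hD := congr_arg D hx₃
      simp only [addX, map_add, map_sub, Derivation.leibniz, Derivation.leibniz_pow, smul_eq_mul,
        nsmul_eq_mul, ha₁, ha₂, hDℓ, hu₁.1, hu₂.1] at hD
      push_cast at hD
      linear_combination hD + 2 * (u₁ + u₂) * hy₃ - 2 * u₂ * on_line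
    refine ⟨hDx, ?_⟩
    have hD := congr_arg D hy₃
    rw [map_add, Derivation.leibniz, map_sub, hDx, hDℓ, hu₁.1, hu₁.2, smul_eq_mul,
      smul_eq_mul] at hD
    linear_combination hD + u₁ * gradient₁ + (u₁ + u₂) * gradient₃
  rw [addY, negAddY, ← hx₃, ← hy₃, ← neg_neg (u₁ + u₂)]
  exact third_point.neg

/-- The velocity of a point under the derivation `D`, relative to the invariant vector field, as a
homomorphism to the additive group. -/
noncomputable def velocity (D : Derivation R F F) : (W⁄F).Point →+ F where
  toFun
    | 0 => 0
    | .some _ _ h => (exists_hasVelocity D h).choose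
  map_zero' := rfl
  map_add' := by
    rintro (_ | ⟨x₁, y₁, h₁⟩) (_ | ⟨x₂, y₂, h₂⟩)
    · exact (add_zero _).symm
    · exact (zero_add _).symm
    · exact (add_zero _).symm
    have hu₁ := (exists_hasVelocity D h₁).choose_spec
    have hu₂ := (exists_hasVelocity D h₂).choose_spec
    by_cases hxy : x₁ = x₂ ∧ y₁ = (W⁄F).negY x₂ y₂
    · obtain ⟨rfl, rfl⟩ := hxy
      rw [Point.add_of_Y_eq rfl rfl]
      exact (add_eq_zero_iff_eq_neg.mpr (hu₁.unique h₁ hu₂.neg)).symm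
    · rw [Point.add_some hxy]
      have h₃ := nonsingular_add h₁ h₂ hxy
      exact (exists_hasVelocity D h₃).choose_spec.unique h₃ (hu₁.add h₁ h₂ hxy hu₂ rfl)

theorem hasVelocity_velocity {x y : F} (h : (W⁄F).Nonsingular x y) :
    HasVelocity (W⁄F) D x y (velocity D (.some x y h)) :=
  (exists_hasVelocity D h).choose_spec

theorem derivation_eq_zero_of_nsmul_eq_zero {m : ℕ} (hm : (m : F) ≠ 0) {x y : F}
    {h : (W⁄F).Nonsingular x y} (hP : m • Point.some x y h = 0) : D x = 0 ∧ D y = 0 := by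
  have velocity_zero : velocity D (.some x y h) = 0 := by
    have := congr_arg (velocity D) hP
    rw [map_nsmul, map_zero, nsmul_eq_mul] at this
    exact (mul_eq_zero_iff_left hm).mp this
  have hu := hasVelocity_velocity (D := D) h
  rw [velocity_zero] at hu
  exact ⟨hu.1.trans (mul_zero _), hu.2.trans (mul_zero _)⟩

end Add

end InvariantVelocity

section Separability

open WeierstrassCurve.Affine IntermediateField

variable {K E : Type*} [Field K] [Field E] [Algebra K E]

theorem isSeparable_of_derivation_eq_zero [Algebra.EssFiniteType K E]
    (h : ∀ D : Derivation K E E, D = 0) : Algebra.IsSeparable K E := by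
  rw [← Algebra.FormallyUnramified.iff_isSeparable]
  refine ⟨subsingleton_of_forall_eq 0 fun ω ↦
    (Module.forall_dual_apply_eq_zero_iff E ω).mp fun f ↦ ?_⟩
  have hf : f = 0 := (KaehlerDifferential.linearMapEquivDerivation K E).injective
    ((h _).trans (map_zero _).symm)
  rw [hf, LinearMap.zero_apply]

theorem derivation_eq_zero_of_adjoin {S : Set E} (D : Derivation K (adjoin K S) (adjoin K S))
    (h : ∀ x (hx : x ∈ S), D ⟨x, subset_adjoin K S hx⟩ = 0) : D = 0 := by
  ext ⟨x, hx⟩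
  refine congr_arg Subtype.val (?_ : D ⟨x, hx⟩ = 0)
  induction hx using adjoin_induction with
  | mem x hx => exact h x hx
  | algebraMap x => exact D.map_algebraMap x
  | add x y hx hy hDx hDy => exact (map_add D ⟨x, hx⟩ ⟨y, hy⟩).trans (by rw [hDx, hDy, add_zero])
  | inv x hx hDx => exact (D.leibniz_inv ⟨x, hx⟩).trans (by rw [hDx, smul_zero])
  | mul x y hx hy hDx hDy =>
    exact (D.leibniz ⟨x, hx⟩ ⟨y, hy⟩).trans (by rw [hDx, hDy, smul_zero, smul_zero, add_zero])

theorem isSeparable_adjoin_pair_of_nsmul_eq_zero [DecidableEq E] {W : WeierstrassCurve.Affine K}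
    {m : ℕ} (hm : (m : K) ≠ 0) {x y : E} {h : (W⁄E).Nonsingular x y}
    (hP : m • Point.some x y h = 0) : Algebra.IsSeparable K (adjoin K {x, y}) := by
  classical
  let L := adjoin K {x, y}
  have : Algebra.EssFiniteType K L :=
    essFiniteType_iff.mpr (fg_adjoin_of_finite (Set.toFinite _))
  have hx : x ∈ L := subset_adjoin K _ (.inl rfl)
  have hy : y ∈ L := subset_adjoin K _ (.inr rfl)
  have hL : (W⁄L).Nonsingular ⟨x, hx⟩ ⟨y, hy⟩ :=
    (W.baseChange_nonsingular (f := L.val) L.val.injective ⟨x, hx⟩ ⟨y, hy⟩).mp h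
  have hPL : m • Point.some (⟨x, hx⟩ : L) ⟨y, hy⟩ hL = 0 := by
    apply Point.map_injective L.val
    rw [map_nsmul, Point.map_some, map_zero]
    exact hP
  have hmL : (m : L) ≠ 0 := by
    rw [← map_natCast (algebraMap K L)]
    exact (map_ne_zero _).mpr hm
  refine isSeparable_of_derivation_eq_zero fun D ↦ derivation_eq_zero_of_adjoin D ?_
  obtain ⟨hDx, hDy⟩ := derivation_eq_zero_of_nsmul_eq_zero (D := D) hmL hPL
  rintro z (rfl | rfl)
  exacts [hDx, hDy]

end Separability

section DivisionField

open WeierstrassCurve.Affine IntermediateField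

variable {K : Type*} [Field K] (W : WeierstrassCurve K) (m : ℕ)

open Classical in
/-- The affine coordinates of the geometric `m`-torsion points of `W`, which generate the
`m`-division field. -/
def torsionCoordinates : Set (AlgebraicClosure K) :=
  {z | ∃ (x y : AlgebraicClosure K) (h : (W.toAffine⁄(AlgebraicClosure K)).Nonsingular x y),
    m • Point.some x y h = 0 ∧ (z = x ∨ z = y)}

theorem divisionField_eq_adjoin : divisionField W m = adjoin K (torsionCoordinates W m) :=
  rfl

theorem isSeparable_divisionField {m : ℕ} (hm : (m : K) ≠ 0) :
    Algebra.IsSeparable K (divisionField W m) := by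
  classical
  rw [divisionField_eq_adjoin, isSeparable_adjoin_iff_isSeparable]
  rintro z ⟨x, y, h, hP, hz⟩
  have := isSeparable_adjoin_pair_of_nsmul_eq_zero hm hP
  exact (isSeparable_adjoin_iff_isSeparable K _).mp this z hz

theorem normal_divisionField : Normal K (divisionField W m) := by
  classical
  rw [normal_iff_forall_map_le']
  intro σ
  rw [divisionField_eq_adjoin, adjoin_map, adjoin_le_iff]
  rintro _ ⟨z, ⟨x, y, h, hP, hz⟩, rfl⟩
  have hσP := congr_arg (Point.map (W' := W) σ.toAlgHom) hP
  rw [map_nsmul, map_zero, Point.map_some] at hσP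
  exact subset_adjoin K _ ⟨σ x, σ y, _, hσP, hz.imp (congr_arg σ) (congr_arg σ)⟩

end DivisionField

section SevenDivisionPolynomial

open Polynomial WeierstrassCurve.Affine

variable {R : Type*} [CommRing R] (W : WeierstrassCurve R)

theorem eval_Ψ₂Sq (x : R) :
    W.Ψ₂Sq.eval x = 4 * x ^ 3 + W.b₂ * x ^ 2 + 2 * W.b₄ * x + W.b₆ := by
  simp [WeierstrassCurve.Ψ₂Sq]

theorem eval_Ψ₃ (x : R) :
    W.Ψ₃.eval x = 3 * x ^ 4 + W.b₂ * x ^ 3 + 3 * W.b₄ * x ^ 2 + 3 * W.b₆ * x + W.b₈ := by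
  simp [WeierstrassCurve.Ψ₃]

theorem eval_preΨ₄ (x : R) : W.preΨ₄.eval x =
    (6 * x ^ 2 + W.b₂ * x + W.b₄) * W.Ψ₃.eval x - W.Ψ₂Sq.eval x ^ 2 := by
  rw [eval_Ψ₂Sq, eval_Ψ₃]
  simp only [WeierstrassCurve.preΨ₄, eval_add, eval_mul, eval_pow, eval_C, eval_X, eval_ofNat]
  linear_combination x ^ 2 * W.b_relation

theorem eval_preΨ'_seven (x : R) : (W.preΨ' 7).eval x =
    (W.preΨ₄.eval x * W.Ψ₂Sq.eval x ^ 2 - W.Ψ₃.eval x ^ 3) * W.Ψ₃.eval x ^ 3 -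
      W.Ψ₂Sq.eval x ^ 2 * W.preΨ₄.eval x ^ 3 := by
  have five := W.preΨ'_odd 0
  have seven := W.preΨ'_odd 1
  norm_num at five seven
  simp only [seven, five, eval_sub, eval_mul, eval_pow]
  ring

theorem sq_add_four_mul_eval_Ψ₃ (x : R) :
    (6 * x ^ 2 + W.b₂ * x + W.b₄) ^ 2 + 4 * W.Ψ₃.eval x = (12 * x + W.b₂) * W.Ψ₂Sq.eval x := by
  rw [eval_Ψ₂Sq, eval_Ψ₃]
  linear_combination W.b_relation

theorem eval_Ψ₃_add (x t : R) : W.Ψ₃.eval (x + t) = W.Ψ₃.eval x + 3 * W.Ψ₂Sq.eval x * t +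
    3 * (6 * x ^ 2 + W.b₂ * x + W.b₄) * t ^ 2 + (12 * x + W.b₂) * t ^ 3 + 3 * t ^ 4 := by
  rw [eval_Ψ₂Sq, eval_Ψ₃, eval_Ψ₃]
  ring

theorem eval_Ψ₃_of_mul_sub_eq {x x₂ : R} (h : W.Ψ₂Sq.eval x * (x₂ - x) = -W.Ψ₃.eval x) :
    W.Ψ₂Sq.eval x ^ 4 * W.Ψ₃.eval x₂ = W.Ψ₃.eval x *
      (W.preΨ₄.eval x * W.Ψ₂Sq.eval x ^ 2 - W.preΨ₄.eval x ^ 2 - W.Ψ₃.eval x ^ 3) := by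
  have taylor := eval_Ψ₃_add W x (x₂ - x)
  rw [add_sub_cancel] at taylor
  set q := 6 * x ^ 2 + W.b₂ * x + W.b₄
  set s := W.Ψ₂Sq.eval x
  set t := W.Ψ₃.eval x
  have expansion : s ^ 4 * W.Ψ₃.eval x₂ =
      t * (-2 * s ^ 4 + 3 * q * t * s ^ 2 - (12 * x + W.b₂) * s * t ^ 2 + 3 * t ^ 3) := by
    linear_combination s ^ 4 * taylor + (3 * s ^ 4 + 3 * q * s ^ 2 * (s * (x₂ - x) - t) +
      (12 * x + W.b₂) * s * (s ^ 2 * (x₂ - x) ^ 2 - s * (x₂ - x) * t + t ^ 2) +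
      3 * (s * (x₂ - x) - t) * (s ^ 2 * (x₂ - x) ^ 2 + t ^ 2)) * h
  rw [expansion, ← sq_add_four_mul_eval_Ψ₃, eval_preΨ₄]
  ring

variable {W}

theorem sub_negY_sq {x y : R} (h : W.toAffine.Equation x y) :
    (y - W.toAffine.negY x y) ^ 2 = W.Ψ₂Sq.eval x := by
  rw [eval_Ψ₂Sq, negY, WeierstrassCurve.b₂, WeierstrassCurve.b₄, WeierstrassCurve.b₆]
  linear_combination 4 * (W.toAffine.equation_iff x y).mp h

variable {F : Type*} [Field F] {W : WeierstrassCurve F}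

theorem mul_addX_self_sub [DecidableEq F] {x y : F} (h : W.toAffine.Equation x y)
    (hy : y ≠ W.toAffine.negY x y) :
    W.Ψ₂Sq.eval x * (W.toAffine.addX x x (W.toAffine.slope x x y y) - x) = -W.Ψ₃.eval x := by
  have tangent := slope_mul_sub_negY hy
  rw [← sub_negY_sq h, eval_Ψ₃, addX, negY, WeierstrassCurve.b₂, WeierstrassCurve.b₄,
    WeierstrassCurve.b₆, WeierstrassCurve.b₈]
  linear_combination ((2 * y + W.a₁ * x + W.a₃) * (W.toAffine.slope x x y y + W.a₁) +
    (3 * x ^ 2 + 2 * W.a₂ * x + W.a₄ - W.a₁ * y)) * tangent -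
    (12 * x + W.a₁ ^ 2 + 4 * W.a₂) * (W.toAffine.equation_iff x y).mp h

theorem pow_mul_addY_self_sub_negY [DecidableEq F] {x y : F} (h : W.toAffine.Equation x y)
    (hy : y ≠ W.toAffine.negY x y) {x₂ y₂ : F}
    (hx₂ : x₂ = W.toAffine.addX x x (W.toAffine.slope x x y y))
    (hy₂ : y₂ = W.toAffine.addY x x y (W.toAffine.slope x x y y)) :
    (y - W.toAffine.negY x y) ^ 3 * (y₂ - W.toAffine.negY x₂ y₂) = W.preΨ₄.eval x := by
  have tangent := slope_mul_sub_negY hy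
  have doubling := mul_addX_self_sub h hy
  rw [← hx₂] at doubling
  rw [hy₂, addY, negAddY, ← hx₂, eval_preΨ₄]
  rw [← sub_negY_sq h] at doubling ⊢
  simp only [negY, WeierstrassCurve.b₂, WeierstrassCurve.b₄] at doubling ⊢
  linear_combination -2 * (2 * y + W.a₁ * x + W.a₃) ^ 2 * (x₂ - x) * tangent -
    (6 * x ^ 2 + (W.a₁ ^ 2 + 4 * W.a₂) * x + (2 * W.a₄ + W.a₁ * W.a₃)) * doubling

variable [DecidableEq F]

theorem exists_two_nsmul_eq {x y : F} {h : W.toAffine.Nonsingular x y}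
    (hP : 2 • Point.some x y h ≠ 0) : ∃ x₂ y₂ h₂, 2 • Point.some x y h = .some x₂ y₂ h₂ ∧
      W.Ψ₂Sq.eval x * (x₂ - x) = -W.Ψ₃.eval x ∧
      (y - W.toAffine.negY x y) ^ 3 * (y₂ - W.toAffine.negY x₂ y₂) = W.preΨ₄.eval x := by
  have hy : y ≠ W.toAffine.negY x y := fun hy ↦ hP (by rw [two_nsmul, Point.add_self_of_Y_eq hy])
  exact ⟨_, _, _, (two_nsmul _).trans (Point.add_self_of_Y_ne hy), mul_addX_self_sub h.1 hy,
    pow_mul_addY_self_sub_negY h.1 hy rfl rfl⟩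

theorem Ψ₂Sq_eval_ne_zero {x y : F} {h : W.toAffine.Nonsingular x y}
    (hP : 2 • Point.some x y h ≠ 0) : W.Ψ₂Sq.eval x ≠ 0 := by
  rw [← sub_negY_sq h.1]
  exact pow_ne_zero _ (sub_ne_zero.mpr fun hy ↦ hP (by rw [two_nsmul, Point.add_self_of_Y_eq hy]))

theorem Ψ₃_eval_ne_zero {x y : F} {h : W.toAffine.Nonsingular x y} (hP₁ : 2 • Point.some x y h ≠ 0)
    (hP : 3 • Point.some x y h ≠ 0) : W.Ψ₃.eval x ≠ 0 := by
  obtain ⟨x₂, y₂, h₂, hP₂, hx₂, -⟩ := exists_two_nsmul_eq hP₁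
  intro hΨ
  rw [hΨ, neg_zero, mul_eq_zero_iff_left (Ψ₂Sq_eval_ne_zero hP₁), sub_eq_zero] at hx₂
  rcases (Point.X_eq_iff (h₁ := h₂) (h₂ := h)).mp hx₂ with hPP | hPP
  · rw [← hP₂, two_nsmul, add_eq_right] at hPP
    exact Point.some_ne_zero h hPP
  · rw [← hP₂, eq_neg_iff_add_eq_zero, ← succ_nsmul] at hPP
    exact hP hPP

-- Compare `x(P + Q)` with `x(P - Q)` for `Q = 2P`.
theorem exists_three_nsmul_eq {x y : F} {h : W.toAffine.Nonsingular x y}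
    (hP₁ : 2 • Point.some x y h ≠ 0) (hP : 3 • Point.some x y h ≠ 0) :
    ∃ x₃ y₃ h₃, 3 • Point.some x y h = .some x₃ y₃ h₃ ∧
      W.Ψ₃.eval x ^ 2 * (x₃ - x) = -(W.preΨ₄.eval x * W.Ψ₂Sq.eval x) := by
  obtain ⟨x₂, y₂, h₂, hP₂, hx₂, hy₂⟩ := exists_two_nsmul_eq hP₁
  have hx : x ≠ x₂ := fun hx ↦ Ψ₃_eval_ne_zero hP₁ hP
    (by rw [← neg_eq_zero, ← hx₂, hx, sub_self, mul_zero])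
  have hx_sub : W.toAffine.addX x x₂ (W.toAffine.slope x x₂ y (W.toAffine.negY x₂ y₂)) = x := by
    have hsub : Point.some x y h + -Point.some x₂ y₂ h₂ = -Point.some x y h := by
      rw [← hP₂, two_nsmul, neg_add, add_neg_cancel_left]
    rw [Point.neg_some, Point.neg_some, Point.add_of_X_ne hx] at hsub
    exact ((Point.some.injEq ..).mp hsub).1
  refine ⟨_, _, _, (succ_nsmul' _ 2).trans (hP₂ ▸ Point.add_of_X_ne hx), ?_⟩
  have hΨ : W.Ψ₃.eval x ^ 2 = W.Ψ₂Sq.eval x ^ 2 * (x₂ - x) ^ 2 := by rw [← mul_pow, hx₂, neg_sq]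
  rw [addX_eq_addX_negY_sub _ _ hx, hx_sub, hΨ, ← hy₂, ← sub_negY_sq h.1]
  have hd : x₂ - x ≠ 0 := sub_ne_zero.mpr hx.symm
  field_simp
  ring

theorem eval_preΨ'_seven_eq_zero {x y : F} {h : W.toAffine.Nonsingular x y}
    (hP : 7 • Point.some x y h = 0) : (W.preΨ' 7).eval x = 0 := by
  have order : addOrderOf (Point.some x y h) = 7 := addOrderOf_eq_prime hP (Point.some_ne_zero h)
  have ne_zero (n : ℕ) (hn : ¬7 ∣ n) : n • Point.some x y h ≠ 0 := fun hn' ↦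
    hn (order ▸ addOrderOf_dvd_iff_nsmul_eq_zero.mpr hn')
  obtain ⟨x₂, y₂, h₂, hP₂, hx₂, hy₂⟩ := exists_two_nsmul_eq (ne_zero 2 (by norm_num))
  obtain ⟨x₃, y₃, h₃, hP₃, hx₃⟩ :=
    exists_three_nsmul_eq (ne_zero 2 (by norm_num)) (ne_zero 3 (by norm_num))
  obtain ⟨x₄, y₄, h₄, hP₄, hx₄, -⟩ := exists_two_nsmul_eq (h := h₂)
    (by rw [← hP₂, ← mul_nsmul]; exact ne_zero 4 (by norm_num))
  have hx : x₃ = x₄ := by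
    refine Point.X_eq_iff.mpr (.inr (?_ : Point.some x₃ y₃ h₃ = -Point.some x₄ y₄ h₄))
    rw [← hP₃, ← hP₄, ← hP₂, ← mul_nsmul, eq_neg_iff_add_eq_zero, ← add_nsmul, hP]
  have hΨ := eval_Ψ₃_of_mul_sub_eq W hx₂
  have hs : W.Ψ₂Sq.eval x ^ 3 * W.Ψ₂Sq.eval x₂ = W.preΨ₄.eval x ^ 2 := by
    rw [← hy₂, ← sub_negY_sq h.1, ← sub_negY_sq h₂.1]
    ring
  have quadruple : W.Ψ₂Sq.eval x * W.preΨ₄.eval x ^ 2 * (x₄ - x) =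
      -(W.Ψ₃.eval x * (W.preΨ₄.eval x * W.Ψ₂Sq.eval x ^ 2 - W.Ψ₃.eval x ^ 3)) := by
    linear_combination W.Ψ₂Sq.eval x ^ 4 * hx₄ - W.Ψ₂Sq.eval x * (x₄ - x₂) * hs +
      W.preΨ₄.eval x ^ 2 * hx₂ - hΨ
  rw [eval_preΨ'_seven]
  rw [hx] at hx₃
  linear_combination W.Ψ₃.eval x ^ 2 * quadruple -
    W.Ψ₂Sq.eval x * W.preΨ₄.eval x ^ 2 * hx₃

end SevenDivisionPolynomial

section Scaling

open WeierstrassCurve WeierstrassCurve.Affine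

variable {F : Type*} [Field F] {W : WeierstrassCurve F} {u : Fˣ}

theorem coefficients_of_scaling_smul_eq (hu : VariableChange.mk u 0 0 0 • W = W) :
    W.a₁ = u * W.a₁ ∧ W.a₂ = u ^ 2 * W.a₂ ∧ W.a₃ = u ^ 3 * W.a₃ ∧ W.a₄ = u ^ 4 * W.a₄ ∧
      W.a₆ = u ^ 6 * W.a₆ := by
  rw [WeierstrassCurve.ext_iff] at hu
  simpa [variableChange_def, inv_mul_eq_iff_eq_mul₀] using hu

theorem negY_scaling (hu : VariableChange.mk u 0 0 0 • W = W) (x y : F) :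
    W.toAffine.negY (u ^ 2 * x) (u ^ 3 * y) = u ^ 3 * W.toAffine.negY x y := by
  obtain ⟨h₁, -, h₃, -⟩ := coefficients_of_scaling_smul_eq hu
  rw [negY, negY]
  linear_combination -u ^ 2 * x * h₁ - h₃

theorem nonsingular_scaling (hu : VariableChange.mk u 0 0 0 • W = W) {x y : F}
    (h : W.toAffine.Nonsingular x y) : W.toAffine.Nonsingular (u ^ 2 * x) (u ^ 3 * y) := by
  obtain ⟨h₁, h₂, h₃, h₄, h₆⟩ := coefficients_of_scaling_smul_eq hu
  rw [nonsingular_iff', equation_iff] at h ⊢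
  refine ⟨?_, h.2.imp (fun hx ↦ ?_) fun hy ↦ ?_⟩
  · linear_combination u ^ 6 * h.1 + u ^ 5 * x * y * h₁ + u ^ 3 * y * h₃ -
      u ^ 4 * x ^ 2 * h₂ - u ^ 2 * x * h₄ - h₆
  · convert mul_ne_zero (u ^ 4).ne_zero hx using 1
    push_cast
    linear_combination u ^ 3 * y * h₁ - 2 * u ^ 2 * x * h₂ - h₄
  · convert mul_ne_zero (u ^ 3).ne_zero hy using 1
    push_cast
    linear_combination u ^ 2 * x * h₁ + h₃

theorem addX_scaling (hu : VariableChange.mk u 0 0 0 • W = W) (x₁ x₂ ℓ : F) :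
    W.toAffine.addX (u ^ 2 * x₁) (u ^ 2 * x₂) (u * ℓ) = u ^ 2 * W.toAffine.addX x₁ x₂ ℓ := by
  obtain ⟨h₁, h₂, -⟩ := coefficients_of_scaling_smul_eq hu
  rw [addX, addX]
  linear_combination u * ℓ * h₁ - h₂

theorem addY_scaling (hu : VariableChange.mk u 0 0 0 • W = W) (x₁ x₂ y₁ ℓ : F) :
    W.toAffine.addY (u ^ 2 * x₁) (u ^ 2 * x₂) (u ^ 3 * y₁) (u * ℓ) =
      u ^ 3 * W.toAffine.addY x₁ x₂ y₁ ℓ := by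
  rw [addY, addY, ← negY_scaling hu, negAddY, negAddY, addX_scaling hu]
  congr 1
  ring

variable [DecidableEq F]

theorem slope_scaling (hu : VariableChange.mk u 0 0 0 • W = W) {x₁ y₁ x₂ y₂ : F}
    (hxy : ¬(x₁ = x₂ ∧ y₁ = W.toAffine.negY x₂ y₂)) :
    W.toAffine.slope (u ^ 2 * x₁) (u ^ 2 * x₂) (u ^ 3 * y₁) (u ^ 3 * y₂) =
      u * W.toAffine.slope x₁ x₂ y₁ y₂ := by
  obtain ⟨h₁, h₂, -, h₄, -⟩ := coefficients_of_scaling_smul_eq hu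
  have u2 : (u : F) ^ 2 ≠ 0 := pow_ne_zero 2 u.ne_zero
  have u3 : (u : F) ^ 3 ≠ 0 := pow_ne_zero 3 u.ne_zero
  by_cases hx : x₁ = x₂
  · have hy : y₁ ≠ W.toAffine.negY x₂ y₂ := fun hy ↦ hxy ⟨hx, hy⟩
    have hy' : u ^ 3 * y₁ ≠ W.toAffine.negY (u ^ 2 * x₂) (u ^ 3 * y₂) := by
      rwa [negY_scaling hu, (mul_right_injective₀ u3).ne_iff]
    rw [slope_of_Y_ne hx hy, slope_of_Y_ne (by rw [hx]) hy', negY_scaling hu, ← mul_sub,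
      ← mul_div_mul_left _ (y₁ - _) u3, ← mul_div_assoc]
    congr 1
    linear_combination 2 * u ^ 2 * x₁ * h₂ + h₄ - u ^ 3 * y₁ * h₁
  · rw [slope_of_X_ne hx, slope_of_X_ne ((mul_right_injective₀ u2).ne hx), ← mul_sub, ← mul_sub,
      ← mul_div_mul_left _ (x₁ - x₂) u2]
    ring

/-- The endomorphism `(x, y) ↦ (u²x, u³y)` of the points of a Weierstrass curve that is preserved
by the change of variables scaling by `u`. -/
def scalingEnd (hu : VariableChange.mk u 0 0 0 • W = W) : AddMonoid.End W.toAffine.Point where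
  toFun
    | 0 => 0
    | .some x y h => .some (u ^ 2 * x) (u ^ 3 * y) (nonsingular_scaling hu h)
  map_zero' := rfl
  map_add' := by
    rintro (_ | ⟨x₁, y₁, h₁⟩) (_ | ⟨x₂, y₂, h₂⟩)
    · rfl
    · exact (zero_add _).symm
    · exact (add_zero _).symm
    by_cases hxy : x₁ = x₂ ∧ y₁ = W.toAffine.negY x₂ y₂
    · obtain ⟨rfl, rfl⟩ := hxy
      rw [Point.add_of_Y_eq rfl rfl]
      exact (Point.add_of_Y_eq rfl (negY_scaling hu _ _).symm).symm
    · have hxy' : ¬(u ^ 2 * x₁ = u ^ 2 * x₂ ∧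
          u ^ 3 * y₁ = W.toAffine.negY (u ^ 2 * x₂) (u ^ 3 * y₂)) := by
        rwa [negY_scaling hu, (mul_right_injective₀ (pow_ne_zero 2 u.ne_zero)).eq_iff,
          (mul_right_injective₀ (pow_ne_zero 3 u.ne_zero)).eq_iff]
      rw [Point.add_some hxy]
      refine Eq.trans ?_ (Point.add_some hxy').symm
      refine (Point.some.injEq ..).mpr ⟨?_, ?_⟩
      · rw [slope_scaling hu hxy, addX_scaling hu]
      · rw [slope_scaling hu hxy, addY_scaling hu]

theorem scalingEnd_mul_self (hu : VariableChange.mk u 0 0 0 • W = W) (hu2 : (u : F) ^ 2 = -1)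
    (h₁ : W.a₁ = 0) (h₃ : W.a₃ = 0) : scalingEnd hu * scalingEnd hu = -1 := by
  ext (_ | ⟨x, y, h⟩)
  · rfl
  · refine (Point.some.injEq ..).mpr ⟨?_, ?_⟩
    · linear_combination (u ^ 2 - 1) * x * hu2
    · rw [negY, h₁, h₃]
      linear_combination (u ^ 4 - u ^ 2 + 1) * y * hu2

theorem scalingEnd_neg (hu : VariableChange.mk u 0 0 0 • W = W)
    (hu' : VariableChange.mk (-u) 0 0 0 • W = W) (h₁ : W.a₁ = 0) (h₃ : W.a₃ = 0) :
    scalingEnd hu' = -scalingEnd hu := by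
  ext (_ | ⟨x, y, h⟩)
  · rfl
  · refine (Point.some.injEq ..).mpr ⟨?_, ?_⟩
    · push_cast
      ring
    · rw [negY, h₁, h₃]
      push_cast
      ring

end Scaling

section TorsionCount

open Polynomial WeierstrassCurve.Affine

variable {F : Type*} [Field F] {W : WeierstrassCurve.Affine F}

theorem encard_setOf_X_eq_le (x : F) : {P : W.Point | ∃ y h, P = .some x y h}.encard ≤ 2 := by
  rcases Set.eq_empty_or_nonempty {P : W.Point | ∃ y h, P = .some x y h} with h | ⟨P, y, h, rfl⟩
  · simp [h]
  · refine (Set.encard_le_encard (t := {.some x y h, -.some x y h}) ?_).trans <|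
      (Set.encard_insert_le _ _).trans (by rw [Set.encard_singleton, one_add_one_eq_two])
    rintro _ ⟨y', h', rfl⟩
    exact Point.X_eq_iff.mp rfl

theorem encard_le_of_eval_eq_zero {p : F[X]} (hp : p ≠ 0) {S : Set W.Point}
    (hS : ∀ x y h, Point.some x y h ∈ S → p.eval x = 0) : S.encard ≤ 2 * p.natDegree + 1 := by
  classical
  have subset : S ⊆ insert 0 (⋃ x ∈ p.roots.toFinset, {P | ∃ y h, P = .some x y h}) := by
    rintro (_ | ⟨x, y, h⟩) hP
    · exact .inl rfl
    · have hx : x ∈ p.roots.toFinset := by simpa [hp] using hS x y h hP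
      exact .inr (Set.mem_iUnion₂_of_mem hx ⟨y, h, rfl⟩)
  calc
    S.encard ≤ (⋃ x ∈ p.roots.toFinset, {P : W.Point | ∃ y h, P = .some x y h}).encard + 1 :=
      (Set.encard_le_encard subset).trans (Set.encard_insert_le _ _)
    _ ≤ ∑ x ∈ p.roots.toFinset, {P : W.Point | ∃ y h, P = .some x y h}.encard + 1 := by
      gcongr
      exact Finset.set_encard_biUnion_le _ _
    _ ≤ p.roots.toFinset.card • 2 + 1 := by
      gcongr
      exact Finset.sum_le_card_nsmul _ _ _ fun x _ ↦ encard_setOf_X_eq_le x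
    _ ≤ 2 * p.natDegree + 1 := by
      rw [nsmul_eq_mul, mul_comm]
      gcongr
      exact p.roots.toFinset_card_le.trans p.card_roots'

attribute [local instance] AddSubgroup.torsionBy.zmodModule

theorem finite_torsionBy_seven_and_finrank_le [DecidableEq F] {W : WeierstrassCurve F}
    (hW : W.preΨ' 7 ≠ 0) : Finite (AddSubgroup.torsionBy W.toAffine.Point (7 : ℕ)) ∧
      Module.finrank (ZMod 7) (AddSubgroup.torsionBy W.toAffine.Point (7 : ℕ)) ≤ 2 := by
  have encard_le :
      (AddSubgroup.torsionBy W.toAffine.Point (7 : ℕ) : Set W.toAffine.Point).encard ≤ 49 := by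
    refine (encard_le_of_eval_eq_zero hW fun x y h hP ↦
      eval_preΨ'_seven_eq_zero (AddSubgroup.torsionBy.nsmul_iff.mp hP)).trans ?_
    have := W.natDegree_preΨ'_le 7
    norm_num at this
    exact_mod_cast (by lia : 2 * (W.preΨ' 7).natDegree + 1 ≤ 49)
  have finite : Finite (AddSubgroup.torsionBy W.toAffine.Point (7 : ℕ)) :=
    Set.finite_of_encard_le_coe encard_le
  refine ⟨finite, ?_⟩
  have card_le : Nat.card (AddSubgroup.torsionBy W.toAffine.Point (7 : ℕ)) ≤ 49 :=
    (Set.encard_le_coe_iff_finite_ncard_le.mp encard_le).2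
  rw [Module.natCard_eq_pow_finrank (K := ZMod 7), Nat.card_zmod] at card_le
  exact (Nat.pow_le_pow_iff_right (by norm_num : 1 < 7)).mp card_le

end TorsionCount

section GaloisRepresentation

open WeierstrassCurve.Affine

attribute [local instance] AddSubgroup.torsionBy.zmodModule

/-- The action of the endomorphisms of an abelian group on its `n`-torsion subgroup. -/
def torsionEnd (A : Type*) [AddCommGroup A] (n : ℕ) :
    AddMonoid.End A →+* Module.End (ZMod n) (AddSubgroup.torsionBy A n) where
  toFun f := AddMonoidHom.toZModLinearMap n <|
    (f.comp (AddSubgroup.subtype _)).codRestrict _ fun P ↦ by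
      rw [AddSubgroup.torsionBy.nsmul_iff, ← map_nsmul, AddSubgroup.torsionBy.nsmul, map_zero]
  map_one' := rfl
  map_mul' _ _ := rfl
  map_zero' := rfl
  map_add' _ _ := rfl

variable {K : Type*} [Field K] (W : WeierstrassCurve K) (m : ℕ)

open Classical in
/-- The action of the automorphisms of the algebraic closure on the geometric points of `W`. -/
noncomputable def pointRep :
    Gal(AlgebraicClosure K/K) →* AddMonoid.End (W.toAffine⁄(AlgebraicClosure K)).Point where
  toFun σ := Point.map σ.toAlgHom
  map_one' := by
    ext (_ | _) <;> rfl
  map_mul' σ τ := by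
    ext (_ | _) <;> rfl

open Classical in
/-- The mod `m` Galois representation attached to `W`. -/
noncomputable def torsionRep : Gal(AlgebraicClosure K/K) →*
    Module.End (ZMod m) (AddSubgroup.torsionBy (W.toAffine⁄(AlgebraicClosure K)).Point m) :=
  (torsionEnd _ m).toMonoidHom.comp (pointRep W)

theorem torsionRep_eq_one_iff (σ : Gal(AlgebraicClosure K/K)) :
    torsionRep W m σ = 1 ↔ ∀ z ∈ torsionCoordinates W m, σ z = z := by
  classical
  constructor
  · rintro hσ z ⟨x, y, h, hP, hz⟩
    have hσP := congr_arg Subtype.val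
      (LinearMap.congr_fun hσ ⟨.some x y h, AddSubgroup.torsionBy.nsmul_iff.mpr hP⟩)
    obtain ⟨hx, hy⟩ := (Point.some.injEq ..).mp hσP
    rcases hz with rfl | rfl
    exacts [hx, hy]
  · intro hσ
    ext ⟨_ | ⟨x, y, h⟩, hP⟩
    · rfl
    · have hP := AddSubgroup.torsionBy.nsmul_iff.mp hP
      exact (Point.some.injEq ..).mpr
        ⟨hσ x ⟨x, y, h, hP, .inl rfl⟩, hσ y ⟨x, y, h, hP, .inr rfl⟩⟩

theorem ker_torsionRep : (torsionRep W m).ker = (divisionField W m).fixingSubgroup := by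
  ext σ
  rw [MonoidHom.mem_ker, torsionRep_eq_one_iff, divisionField_eq_adjoin,
    IntermediateField.mem_fixingSubgroup_iff]
  exact (IntermediateField.forall_mem_adjoin_smul_eq_self_iff K σ).symm

theorem nonempty_gal_mulEquiv_range {E T : Type*} [Field E] [Algebra K E] [Normal K E] [Group T]
    (L : IntermediateField K E) [Normal K L] (f : Gal(E/K) →* T) (hf : f.ker = L.fixingSubgroup) :
    Nonempty (Gal(L/K) ≃* f.range) :=
  ⟨(QuotientGroup.quotientKerEquivOfSurjective _
    (AlgEquiv.restrictNormalHom_surjective (F := K) (K₁ := L) E)).symm.trans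
      ((QuotientGroup.quotientMulEquivOfEq (L.restrictNormalHom_ker.trans hf.symm)).trans
        (QuotientGroup.quotientKerEquivRange f))⟩

end GaloisRepresentation

section CurveE1

open WeierstrassCurve

attribute [local instance] AddSubgroup.torsionBy.zmodModule

theorem curveE1_baseChange {F : Type*} [Field F] (A : Type*) [Field A] [Algebra F A] (b : F) :
    (curveE1 b)⁄A = curveE1 (algebraMap F A b) := by
  simp [baseChange, map, curveE1]

theorem scaling_smul_curveE1 {F : Type*} [Field F] {u : Fˣ} (hu : u ^ 4 = 1) (b : F) :
    VariableChange.mk u 0 0 0 • curveE1 b = curveE1 b := by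
  have hu' : ((u : F) ^ 4)⁻¹ = 1 := by
    rw [← Units.val_pow_eq_pow_val, hu, Units.val_one, inv_one]
  simp [variableChange_def, curveE1, hu']

theorem ne_zero_of_isElliptic_curveE1 {F : Type*} [Field F] {b : F} (h : (curveE1 b).IsElliptic) :
    b ≠ 0 := by
  rintro rfl
  exact h.isUnit.ne_zero (by simp [curveE1, Δ, b₂, b₄, b₆, b₈])

-- Modulo `7` only the constant term survives: the curve is supersingular in characteristic `7`.
theorem eval_preΨ'_seven_curveE1 {F : Type*} [Field F] (b x : F) :
    ((curveE1 b).preΨ' 7).eval x =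
      7 * (x ^ 24 + 44 * b * x ^ 22 - 422 * b ^ 2 * x ^ 20 - 2836 * b ^ 3 * x ^ 18 -
        5033 * b ^ 4 * x ^ 16 - 11752 * b ^ 5 * x ^ 14 - 15988 * b ^ 6 * x ^ 12 -
        6024 * b ^ 7 * x ^ 10 + 2239 * b ^ 8 * x ^ 8 + 2108 * b ^ 9 * x ^ 6 +
        186 * b ^ 10 * x ^ 4 + 28 * b ^ 11 * x ^ 2) - b ^ 12 := by
  rw [eval_preΨ'_seven, eval_preΨ₄, eval_Ψ₃, eval_Ψ₂Sq]
  simp only [curveE1, b₂, b₄, b₆, b₈]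
  ring

theorem preΨ'_seven_curveE1_ne_zero {F : Type*} [Field F] {b : F} (hb : b ≠ 0) :
    (curveE1 b).preΨ' 7 ≠ 0 := by
  intro h
  have := eval_preΨ'_seven_curveE1 b 0
  simp [h, hb] at this

variable {K : Type*} [Field K] {b : K}

theorem isGalois_divisionField_seven (hb : b ≠ 0) :
    IsGalois K (divisionField (curveE1 b) 7) where
  to_isSeparable := by
    classical
    by_cases h7 : (7 : K) = 0
    · rw [divisionField_eq_adjoin, IntermediateField.isSeparable_adjoin_iff_isSeparable]
      rintro z ⟨x, y, h, hP, -⟩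
      have eval_zero := eval_preΨ'_seven_eq_zero hP
      rw [curveE1_baseChange, eval_preΨ'_seven_curveE1,
        ← map_ofNat (algebraMap K (AlgebraicClosure K)), h7, map_zero, zero_mul, zero_sub,
        neg_eq_zero, ← map_pow, map_eq_zero] at eval_zero
      exact absurd eval_zero (pow_ne_zero 12 hb)
    · exact isSeparable_divisionField _ h7
  to_normal := normal_divisionField _ 7

open Classical in
theorem pointRep_mul_scalingEnd (W : WeierstrassCurve K) {u v : (AlgebraicClosure K)ˣ}
    (hu : VariableChange.mk u 0 0 0 • W⁄(AlgebraicClosure K) = W⁄(AlgebraicClosure K))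
    (hv : VariableChange.mk v 0 0 0 • W⁄(AlgebraicClosure K) = W⁄(AlgebraicClosure K))
    {σ : Gal(AlgebraicClosure K/K)} (hσ : σ u = v) :
    pointRep W σ * scalingEnd hu = scalingEnd hv * pointRep W σ := by
  ext (_ | ⟨x, y, h⟩)
  · rfl
  · refine (Affine.Point.some.injEq ..).mpr ⟨?_, ?_⟩
    · exact (map_mul σ _ x).trans (by rw [map_pow, hσ]; rfl)
    · exact (map_mul σ _ y).trans (by rw [map_pow, hσ]; rfl)

-- An automorphism maps `i` to `±i`, so it commutes or anticommutes with the complex multiplication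
-- `(x, y) ↦ (-x, -iy)`.
open Classical in
theorem exists_mul_self_eq_neg_one_and_pointRep_mul (b : K) :
    ∃ J : AddMonoid.End ((curveE1 b)⁄(AlgebraicClosure K)).toAffine.Point, J * J = -1 ∧
      ∀ σ, pointRep (curveE1 b) σ * J = J * pointRep (curveE1 b) σ ∨
        pointRep (curveE1 b) σ * J = -(J * pointRep (curveE1 b) σ) := by
  obtain ⟨i, hi⟩ := IsAlgClosed.exists_pow_nat_eq (-1 : AlgebraicClosure K) two_pos
  let u : (AlgebraicClosure K)ˣ := Units.mk0 i (by rintro rfl; simp at hi)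
  have hu : u ^ 4 = 1 := Units.ext ((pow_mul i 2 2).trans (by rw [hi, neg_one_sq, Units.val_one]))
  have smul_eq {v : (AlgebraicClosure K)ˣ} (hv : v ^ 4 = 1) :
      VariableChange.mk v 0 0 0 • (curveE1 b)⁄(AlgebraicClosure K) =
        (curveE1 b)⁄(AlgebraicClosure K) := by
    rw [curveE1_baseChange, scaling_smul_curveE1 hv]
  have hu' : (-u) ^ 4 = 1 := by rw [Even.neg_pow (by decide), hu]
  have ha₁ : ((curveE1 b)⁄(AlgebraicClosure K)).a₁ = 0 := map_zero _
  have ha₃ : ((curveE1 b)⁄(AlgebraicClosure K)).a₃ = 0 := map_zero _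
  refine ⟨scalingEnd (smul_eq hu), scalingEnd_mul_self _ hi ha₁ ha₃, fun σ ↦ ?_⟩
  have hσ : σ i = i ∨ σ i = -i := by
    rw [← sq_eq_sq_iff_eq_or_eq_neg, ← map_pow, hi, map_neg, map_one]
  refine hσ.imp (fun hσ ↦ pointRep_mul_scalingEnd _ _ _ hσ) fun hσ ↦ ?_
  rw [pointRep_mul_scalingEnd _ _ (smul_eq hu') hσ, scalingEnd_neg (smul_eq hu) _ ha₁ ha₃]
  rfl

theorem exists_hom_ker_eq_fixingSubgroup (hb : b ≠ 0) :
    ∃ f : Gal(AlgebraicClosure K/K) →*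
        QuaternionGroup 4 ⋊[semilinearAction] Multiplicative (ZMod 6),
      f.ker = (divisionField (curveE1 b) 7).fixingSubgroup := by
  classical
  have hΨ : ((curveE1 b)⁄(AlgebraicClosure K)).preΨ' 7 ≠ 0 := by
    rw [curveE1_baseChange]
    exact preΨ'_seven_curveE1_ne_zero ((map_ne_zero _).mpr hb)
  obtain ⟨_, finrank_le⟩ := finite_torsionBy_seven_and_finrank_le hΨ
  obtain ⟨J, hJ, hJσ⟩ := exists_mul_self_eq_neg_one_and_pointRep_mul b
  rw [← ker_torsionRep]
  refine exists_hom_semidirectProduct_ker_eq finrank_le (J := torsionEnd _ 7 J) ?_ _ fun σ ↦ ?_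
  · rw [← map_mul, hJ, map_neg, map_one]
  · refine (hJσ σ).imp (fun hσ ↦ ?_) fun hσ ↦ ?_
    · exact (map_mul (torsionEnd _ 7) _ J).symm.trans ((congr_arg _ hσ).trans (map_mul _ J _))
    · exact (map_mul (torsionEnd _ 7) _ J).symm.trans
        ((congr_arg _ hσ).trans ((map_neg _ _).trans (congr_arg _ (map_mul _ J _))))

end CurveE1

theorem theorem3_general :
    ∃ φ : Multiplicative (ZMod 6) →* MulAut (QuaternionGroup 4),
      IsEmpty ((QuaternionGroup 4 ⋊[φ] Multiplicative (ZMod 6)) ≃*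
        (QuaternionGroup 4 × Multiplicative (ZMod 6))) ∧
      ∀ (K : Type*) [Field K] (b : K), (curveE1 b).IsElliptic →
        IsGalois K (divisionField (curveE1 b) 7) ∧
        (∃ H : Subgroup (QuaternionGroup 4 ⋊[φ] Multiplicative (ZMod 6)),
          Nonempty (Gal(divisionField (curveE1 b) 7/K) ≃* H)) ∧
        (Module.finrank K (divisionField (curveE1 b) 7) = 96 →
          Nonempty (Gal(divisionField (curveE1 b) 7/K) ≃*
            (QuaternionGroup 4 ⋊[φ] Multiplicative (ZMod 6)))) := by
  refine ⟨semilinearAction, isEmpty_semidirectProduct_mulEquiv_prod, fun K _ b elliptic ↦ ?_⟩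
  have hb := ne_zero_of_isElliptic_curveE1 elliptic
  have galois := isGalois_divisionField_seven hb
  obtain ⟨f, hf⟩ := exists_hom_ker_eq_fixingSubgroup hb
  obtain ⟨e⟩ := nonempty_gal_mulEquiv_range _ f hf
  refine ⟨galois, ⟨f.range, ⟨e⟩⟩, fun h96 ↦ ?_⟩
  have : FiniteDimensional K (divisionField (curveE1 b) 7) :=
    .of_finrank_pos (h96 ▸ Nat.succ_pos 95)
  have : Finite (QuaternionGroup 4 ⋊[semilinearAction] Multiplicative (ZMod 6)) :=
    Nat.finite_of_card_ne_zero (by rw [card_semidirectProduct]; norm_num)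
  have card_eq : Nat.card f.range =
      Nat.card (QuaternionGroup 4 ⋊[semilinearAction] Multiplicative (ZMod 6)) := by
    rw [card_semidirectProduct, ← h96, ← IsGalois.card_aut_eq_finrank, Nat.card_congr e.toEquiv]
  exact ⟨e.trans ((MulEquiv.subgroupCongr (f.range.eq_top_of_card_eq card_eq)).trans
    Subgroup.topEquiv)⟩

theorem theorem3 :
    ∃ φ : Multiplicative (ZMod 6) →* MulAut (QuaternionGroup 4),
      IsEmpty ((QuaternionGroup 4 ⋊[φ] Multiplicative (ZMod 6)) ≃*
        (QuaternionGroup 4 × Multiplicative (ZMod 6))) ∧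
      ∀ (K : Type*) [Field K] (b : K),
        ringChar K ≠ 2 → ringChar K ≠ 3 → (curveE1 b).IsElliptic →
          IsGalois K (divisionField (curveE1 b) 7) ∧
          (∃ H : Subgroup (QuaternionGroup 4 ⋊[φ] Multiplicative (ZMod 6)),
            Nonempty (Gal(divisionField (curveE1 b) 7/K) ≃* H)) ∧
          (Module.finrank K (divisionField (curveE1 b) 7) = 96 →
            Nonempty (Gal(divisionField (curveE1 b) 7/K) ≃*
              (QuaternionGroup 4 ⋊[φ] Multiplicative (ZMod 6)))) := by
  obtain ⟨φ, isEmpty, gal⟩ := theorem3_general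
  exact ⟨φ, isEmpty, fun K _ b _ _ ↦ gal K b⟩
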